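/- Let $H:\mathbb R^N\times\mathbb R^N\to\mathbb R$ be a continuous function such that - $H(x,\cdot)$ is convex for every $x\in\mathbb R^N$, and $H$ is coercive in $p$ locally uniformly in $x$: for every $R>0$, $\lim_{r\to\infty}\inf\{H(x,p)\mid |x|<R,\ |p|\ge r\}=+\infty$; - there exists $\varepsilon>0$ such that $\limsup_{|x|\to\infty}\,\sup_{|p|<\varepsilon}H(x,p)<\sup_{x\in\mathbb R^N}\,\inf_{p\in\mathbb R^N}H(x,p)$. Let $c=\inf\{a\in\mathbb R\mid H(x,Du)=a \text{ admits a viscosity subsolution in } \mathbb R^N\}$ be the critical value of $H$. Here viscosity subsolutions are upper semicontinuous, viscosity supersolutions are lower semicontinuous, and viscosity solutions are functions that are both. Then for every $\lambda>0$ the discounted equation $$\lambda u+H(x,Du)=c\quad\text{in }\mathbb R^N$$ has a maximal viscosity solution $u_\lambda$, that is, a viscosity solution that satisfies $v\le u_\lambda$ in $\mathbb R^N$ for every viscosity subsolution $v$ of the same equation, and $u_\lambda$ is locally Lipschitz continuous. Moreover, the family $\{u_\lambda\}_{\lambda>0}$ is equibounded from below, i.e. there is $m\in\mathbb R$ with $u_\lambda(x)\ge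 m$ for all $\lambda>0$ and $x\in\mathbb R^N$, and it is relatively compact in $C(\mathbb R^N)$ with the topology of locally uniform convergence. -/

import Mathlib

namespace DiscountedHJ

open Filter Topology Set

/-- `ℝ^N` with its Euclidean norm and scalar product. -/
abbrev Space (N : ℕ) := EuclideanSpace ℝ (Fin N)

/-- Joint continuity of the Hamiltonian in `(x, p)`. -/
def HamContinuous {N : ℕ} (H : Space N → Space N → ℝ) : Prop :=
  Continuous (fun z : Space N × Space N => H z.1 z.2)

/-- Convexity in the momentum variable. -/
def HamConvex {N : ℕ} (H : Space N → Space N → ℝ) : Prop :=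
  ∀ x, ConvexOn ℝ univ (H x)

/-- Coercivity in the momentum variable, locally uniformly in `x`: for any `R > 0`,
`inf {H(x,p) | x ∈ B_R, p ∉ B_r} → +∞` as `r → ∞`. -/
def HamCoercive {N : ℕ} (H : Space N → Space N → ℝ) : Prop :=
  ∀ R : ℝ, 0 < R →
    Tendsto (fun r : ℝ =>
        ⨅ x ∈ Metric.ball (0 : Space N) R, ⨅ p ∈ (Metric.ball (0 : Space N) r)ᶜ, (H x p : EReal))
      atTop (𝓝 ⊤)

/-- The condition at infinity: for some `ε > 0`,
`limsup_{|x| → ∞} max_{p ∈ B_ε} H(x,p) < max_x min_p H(x,p)`, with extended real values. -/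
def HamInfinity {N : ℕ} (H : Space N → Space N → ℝ) : Prop :=
  ∃ ε : ℝ, 0 < ε ∧
    limsup (fun x : Space N => ⨆ p ∈ Metric.ball (0 : Space N) ε, (H x p : EReal))
        (cocompact (Space N))
      < ⨆ x : Space N, ⨅ p : Space N, (H x p : EReal)

/-- `u` is a viscosity subsolution of `lam * u + H(x, Du) = a` in `ℝ^N`. Test functions are of
class `C^1` in a neighbourhood of the touching point. -/
def IsSubsolution {N : ℕ} (H : Space N → Space N → ℝ) (lam a : ℝ) (u : Space N → ℝ) : Prop :=
  UpperSemicontinuous u ∧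
    ∀ (x : Space N) (φ : Space N → ℝ), ContDiffAt ℝ 1 φ x →
      IsLocalMax (fun y => u y - φ y) x → lam * u x + H x (gradient φ x) ≤ a

/-- `u` is a viscosity supersolution of `lam * u + H(x, Du) = a` in `ℝ^N`. -/
def IsSupersolution {N : ℕ} (H : Space N → Space N → ℝ) (lam a : ℝ) (u : Space N → ℝ) : Prop :=
  LowerSemicontinuous u ∧
    ∀ (x : Space N) (φ : Space N → ℝ), ContDiffAt ℝ 1 φ x →
      IsLocalMin (fun y => u y - φ y) x → a ≤ lam * u x + H x (gradient φ x)

/-- `u` is a (continuous) viscosity solution of `lam * u + H(x, Du) = a` in `ℝ^N`. -/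
def IsSolution {N : ℕ} (H : Space N → Space N → ℝ) (lam a : ℝ) (u : Space N → ℝ) : Prop :=
  IsSubsolution H lam a u ∧ IsSupersolution H lam a u

/-- The critical value `c = inf {a | H(x, Du) = a admits subsolutions in ℝ^N}`. -/
noncomputable def criticalValue {N : ℕ} (H : Space N → Space N → ℝ) : ℝ :=
  sInf {a : ℝ | ∃ u : Space N → ℝ, IsSubsolution H 0 a u}

/-- `u` is the maximal solution of `lam * u + H(x, Du) = a`: it is a solution, and it lies above
every subsolution (in particular above every solution). -/
def IsMaximalSolution {N : ℕ} (H : Space N → Space N → ℝ) (lam a : ℝ) (u : Space N → ℝ) : Prop :=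
  IsSolution H lam a u ∧ ∀ v : Space N → ℝ, IsSubsolution H lam a v → ∀ x, v x ≤ u x

end DiscountedHJ

/-! Perron's method with bounds that do not see `lam`. Condition at infinity: outside some ball the
constants are subsolutions at a level `a` strictly below `c`. Choose `C ≥ 0` so that the constant
`-(C / lam)` is a discounted subsolution, and let `u` be the supremum of the subsolutions above it;
maxima with this constant remain subsolutions, so nothing is lost. Such `v` satisfy `lam * v ≥ -C`,
hence `H(x, Dv) ≤ c + C`, and coercivity gives Lipschitz constants on balls independent of `lam`
(`HamCoercive.exists_lipschitz`).

Upper bound (`IsSubsolution.exists_nonpos`): were `v` positive on the ball, its maximum with a small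
positive constant would solve the undiscounted inequality at a level below `c`.

Lower bound (`exists_bounded_subsolution`): a subsolution at level `c + η`, normalized to be
nonpositive on the ball, can be compressed from above by convexity and truncated from below, both
changes acting only where constants are admissible. Its bounds do not depend on `η`; lowering it by
`1 + η / lam` gives a discounted subsolution, and `η → 0`.

Perron's supremum is a solution by the two `isLUB` lemmas, and Arzelà–Ascoli gives compactness. -/

namespace DiscountedHJ

open Filter Topology Set

variable {N : ℕ}

/-! ### Consequences of the hypotheses on the Hamiltonian -/

/-- Bounded sublevels in the momentum variable, uniformly for `x` in a ball. -/
lemma HamCoercive.exists_norm_le {H : Space N → Space N → ℝ} (hcoer : HamCoercive H) {R : ℝ}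
    (hR : 0 < R) (a : ℝ) :
    ∃ L : ℝ, 0 ≤ L ∧ ∀ x p, ‖x‖ < R → H x p ≤ a → ‖p‖ ≤ L := by
  have h := EReal.tendsto_nhds_top_iff_real.1 (hcoer R hR) a
  obtain ⟨r, hr, hr0⟩ := (h.and (eventually_ge_atTop 0)).exists
  refine ⟨r, hr0, fun x p hx hp => ?_⟩
  by_contra! hlt
  have h1 : (⨅ x ∈ Metric.ball (0 : Space N) R, ⨅ p ∈ (Metric.ball (0 : Space N) r)ᶜ,
      (H x p : EReal)) ≤ (H x p : EReal) :=
    (iInf₂_le x (by simpa using hx)).trans (iInf₂_le p (by simpa using hlt.le))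
  exact absurd (EReal.coe_lt_coe_iff.1 (hr.trans_le h1)) (not_lt.2 hp)

/-- Outside a ball `H(x, 0)` lies strictly below `min_p H(x₀, p)` for some `x₀`. -/
lemma HamInfinity.exists_bounds {H : Space N → Space N → ℝ} (hinf : HamInfinity H) :
    ∃ R a b : ℝ, ∃ x₀ : Space N, 0 < R ∧ a < b ∧ (∀ x, R < ‖x‖ → H x 0 ≤ a) ∧
      ∀ p, b ≤ H x₀ p := by
  obtain ⟨ε, hε, h⟩ := hinf
  obtain ⟨x₀, hx₀⟩ := lt_iSup_iff.1 h
  obtain ⟨a, ha1, ha2⟩ := EReal.lt_iff_exists_real_btwn.1 hx₀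
  obtain ⟨b, hb1, hb2⟩ := EReal.lt_iff_exists_real_btwn.1 ha2
  have hev := eventually_lt_of_limsup_lt ha1
  obtain ⟨K, hK, hKs⟩ := mem_cocompact.1 hev
  obtain ⟨R, hR0, hR⟩ := hK.isBounded.subset_closedBall_lt 0 (0 : Space N)
  refine ⟨R, a, b, x₀, hR0, EReal.coe_lt_coe_iff.1 hb1, fun x hx => ?_, fun p => ?_⟩
  · have hxK : x ∈ Kᶜ := fun hxK => by
      have := hR hxK
      rw [mem_closedBall_zero_iff] at this
      linarith
    have h1 := hKs hxK
    have h2 : (H x 0 : EReal) ≤ ⨆ p ∈ Metric.ball (0 : Space N) ε, (H x p : EReal) :=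
      le_iSup₂ (f := fun p (_ : p ∈ Metric.ball (0 : Space N) ε) => (H x p : EReal)) 0
        (Metric.mem_ball_self hε)
    exact (EReal.coe_lt_coe_iff.1 (h2.trans_lt h1)).le
  · exact EReal.coe_le_coe_iff.1 (hb2.le.trans (iInf_le _ p))

lemma HamContinuous.exists_le_of_outside {H : Space N → Space N → ℝ} (hcont : HamContinuous H)
    {R a : ℝ} (h : ∀ x, R < ‖x‖ → H x 0 ≤ a) : ∃ C, ∀ x, H x 0 ≤ C := by
  have hc : Continuous fun x : Space N => H x 0 :=
    hcont.comp (continuous_id.prodMk continuous_const)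
  obtain ⟨C, hC⟩ := (isCompact_closedBall (0 : Space N) R).bddAbove_image hc.continuousOn
  refine ⟨max C a, fun x => ?_⟩
  by_cases hx : R < ‖x‖
  · exact (h x hx).trans (le_max_right _ _)
  · exact (hC ⟨x, by simpa using hx, rfl⟩).trans (le_max_left _ _)

/-! ### Touching from above and Lipschitz estimates -/

/-- Maximum of an upper semicontinuous function minus a test function that dominates it on the
sphere. -/
lemma exists_max_in_ball {u φ : Space N → ℝ} (hu : UpperSemicontinuous u) {x : Space N} {r : ℝ}
    (hr : 0 < r) (hφ : ContinuousOn φ (Metric.closedBall x r))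
    (hs : ∀ y, ‖y - x‖ = r → u y - φ y < u x - φ x) :
    ∃ y, ‖y - x‖ < r ∧ (∀ z, ‖z - x‖ ≤ r → u z - φ z ≤ u y - φ y) ∧
      IsLocalMax (fun z => u z - φ z) y := by
  have husc : UpperSemicontinuousOn (fun z => u z - φ z) (Metric.closedBall x r) := by
    simp only [sub_eq_add_neg]
    exact (hu.upperSemicontinuousOn _).add hφ.neg.upperSemicontinuousOn
  obtain ⟨y, hy, hmax⟩ := husc.exists_isMaxOn ⟨x, Metric.mem_closedBall_self hr.le⟩
    (isCompact_closedBall x r)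
  have hxy : u x - φ x ≤ u y - φ y := hmax (Metric.mem_closedBall_self hr.le)
  have hlt : ‖y - x‖ < r := by
    rw [mem_closedBall_iff_norm] at hy
    refine lt_of_le_of_ne hy fun h => ?_
    exact absurd (hs y h) (not_lt.2 hxy)
  refine ⟨y, hlt, fun z hz => hmax (by rwa [mem_closedBall_iff_norm]), ?_⟩
  refine hmax.isLocalMax (mem_of_superset (Metric.isOpen_ball.mem_nhds ?_)
    Metric.ball_subset_closedBall)
  rwa [mem_ball_iff_norm]

lemma exists_upper_bound {u : Space N → ℝ} (hu : UpperSemicontinuous u) (x : Space N) (r : ℝ) :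
    ∃ M, ∀ y, ‖y - x‖ ≤ r → u y ≤ M := by
  obtain ⟨M, hM⟩ := (hu.upperSemicontinuousOn _).bddAbove_of_isCompact (isCompact_closedBall x r)
  exact ⟨M, fun y hy => hM ⟨y, by rwa [mem_closedBall_iff_norm], rfl⟩⟩

/-- Points at which an upper semicontinuous function is touched from above are dense. -/
lemma exists_touching {u : Space N → ℝ} (hu : UpperSemicontinuous u) (x : Space N) {r : ℝ}
    (hr : 0 < r) :
    ∃ y, ‖y - x‖ < r ∧ ∃ φ : Space N → ℝ, ContDiffAt ℝ 1 φ y ∧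
      IsLocalMax (fun z => u z - φ z) y := by
  obtain ⟨M, hM⟩ := exists_upper_bound hu x r
  -- On the sphere of radius `r` the penalty equals `M - u x + 1`, more than `u` can gain there.
  set A := (M - u x + 1) / r ^ 2
  have hφ : ContDiff ℝ 1 fun z : Space N => A * ‖z - x‖ ^ 2 :=
    contDiff_const.mul ((contDiff_id.sub contDiff_const).norm_sq ℝ)
  obtain ⟨y, hy, -, hmax⟩ := exists_max_in_ball (φ := fun z => A * ‖z - x‖ ^ 2) hu hr
    hφ.continuous.continuousOn (fun y hy => by
      have h1 : A * r ^ 2 = M - u x + 1 := div_mul_cancel₀ _ (by positivity)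
      have := hM y hy.le
      simp only [hy, h1, sub_self, norm_zero]
      linarith)
  exact ⟨y, hy, _, hφ.contDiffAt, hmax⟩

/-- Apply the differential to `y - x`: by homogeneity the derivative of the norm in that direction
is `‖y - x‖`. -/
lemma norm_gradient_radial {g : ℝ → ℝ} {g' : ℝ} {x y : Space N} (hxy : y ≠ x)
    (hg : HasDerivAt g g' ‖y - x‖) :
    g' ≤ ‖gradient (fun z : Space N => g ‖z - x‖) y‖ := by
  have hne : y - x ≠ 0 := sub_ne_zero.2 hxy
  have hpos : 0 < ‖y - x‖ := norm_pos_iff.2 hne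
  have hd : DifferentiableAt ℝ (fun z : Space N => ‖z‖) (y - x) :=
    (contDiffAt_norm ℝ hne (n := 1)).differentiableAt one_ne_zero
  have h1 : HasFDerivAt (fun z : Space N => ‖z - x‖) (fderiv ℝ (fun z : Space N => ‖z‖) (y - x)) y :=
    hd.hasFDerivAt.comp y ((hasFDerivAt_id y).sub_const x)
  have h2 := hg.comp_hasFDerivAt y h1
  have h3 : fderiv ℝ (fun z : Space N => g ‖z - x‖) y (y - x) = g' * ‖y - x‖ := by
    have := h2.fderiv
    rw [show (g ∘ fun z : Space N => ‖z - x‖) = fun z : Space N => g ‖z - x‖ from rfl] at this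
    rw [this]
    simp [hd.fderiv_norm_self]
  have h4 : ‖gradient (fun z : Space N => g ‖z - x‖) y‖
      = ‖fderiv ℝ (fun z : Space N => g ‖z - x‖) y‖ := by
    rw [← toDual_gradient, LinearIsometryEquiv.norm_map]
  have h5 := (le_abs_self _).trans
    ((fderiv ℝ (fun z : Space N => g ‖z - x‖) y).le_opNorm (y - x))
  rw [h3, ← h4] at h5
  exact le_of_mul_le_mul_right h5 hpos

/-- A bound on the gradients of the test functions from above is a Lipschitz bound. -/
lemma le_add_of_gradient_bound {u : Space N → ℝ} (hu : UpperSemicontinuous u) {x : Space N}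
    {r L : ℝ} (hL : 0 ≤ L)
    (h : ∀ y, ‖y - x‖ < r → ∀ φ : Space N → ℝ, ContDiffAt ℝ 1 φ y →
      IsLocalMax (fun z => u z - φ z) y → ‖gradient φ y‖ ≤ L) {y : Space N} (hy : ‖y - x‖ < r) :
    u y ≤ u x + L * ‖y - x‖ := by
  obtain ⟨ρ, hρ1, hρ2⟩ := exists_between hy
  obtain ⟨s, hs1, hs2⟩ := exists_between hρ2
  have hρ0 : 0 < ρ := (norm_nonneg _).trans_lt hρ1
  have hs0 : 0 < s := hρ0.trans hs1
  obtain ⟨M, hM⟩ := exists_upper_bound hu x s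
  have key : ∀ δ : ℝ, 0 < δ → u y ≤ u x + L * ‖y - x‖ + δ * (‖y - x‖ + 1) := by
    intro δ hδ
    obtain ⟨n, hn⟩ := pow_unbounded_of_one_lt ((|M - u x|) / δ) ((one_lt_div hρ0).2 hs1)
    have hn' : M - u x < δ * (s / ρ) ^ (n + 1) := by
      have h1 : (s / ρ) ^ n ≤ (s / ρ) ^ (n + 1) :=
        pow_le_pow_right₀ ((one_lt_div hρ0).2 hs1).le (Nat.le_succ n)
      have h2 := (div_lt_iff₀ hδ).1 (hn.trans_le h1)
      linarith [le_abs_self (M - u x)]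
    -- The slope is at least `L + δ`, so the maximum can only sit at the vertex `x`. The power
    -- exceeds `M - u x` at radius `s` but costs at most `δ` within radius `ρ`.
    set g : ℝ → ℝ := fun t => (L + δ) * t + δ * (t / ρ) ^ (n + 1) with hgdef
    have hgc : ContDiff ℝ 1 g := by rw [hgdef]; fun_prop
    have hg0 : g 0 = 0 := by simp [hgdef]
    obtain ⟨z, hz, hge, hmax⟩ := exists_max_in_ball (φ := fun z => g ‖z - x‖) hu hs0
      (hgc.continuous.comp (by fun_prop)).continuousOn (fun z hz => by
        have := hM z hz.le
        have h3 : 0 ≤ (L + δ) * s := by positivity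
        simp only [hz, sub_self, norm_zero, hg0]
        simp only [hgdef]
        linarith)
    have hzx : z = x := by
      by_contra hne
      have hd : HasDerivAt g ((L + δ) * 1 + δ * ((n + 1 : ℕ) * (‖z - x‖ / ρ) ^ n * (1 / ρ)))
          ‖z - x‖ := by
        have := ((hasDerivAt_id ‖z - x‖).const_mul (L + δ)).add
          ((((hasDerivAt_id ‖z - x‖).div_const ρ).pow (n + 1)).const_mul δ)
        exact this.congr_deriv (by simp)
      have h1 := norm_gradient_radial hne hd
      have hcd : ContDiffAt ℝ 1 (fun w : Space N => g ‖w - x‖) z :=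
        hgc.contDiffAt.comp z ((contDiffAt_id.sub contDiffAt_const).norm ℝ (sub_ne_zero.2 hne))
      have h2 := h z (hz.trans hs2) _ hcd hmax
      have h3 : 0 ≤ δ * ((n + 1 : ℕ) * (‖z - x‖ / ρ) ^ n * (1 / ρ)) := by positivity
      linarith
    have h4 := hge y (hρ1.trans hs1).le
    have h5 : (‖y - x‖ / ρ) ^ (n + 1) ≤ 1 :=
      pow_le_one₀ (by positivity) ((div_le_one hρ0).2 hρ1.le)
    have h6 := mul_le_mul_of_nonneg_left h5 hδ.le
    simp only [hzx, sub_self, norm_zero, hgdef] at h4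
    linarith
  have hlim : Tendsto (fun δ : ℝ => u x + L * ‖y - x‖ + δ * (‖y - x‖ + 1)) (𝓝[>] 0)
      (𝓝 (u x + L * ‖y - x‖ + 0 * (‖y - x‖ + 1))) :=
    (Continuous.tendsto (by fun_prop) 0).mono_left nhdsWithin_le_nhds
  have := ge_of_tendsto hlim (eventually_nhdsWithin_of_forall fun δ hδ => key δ hδ)
  simpa using this

/-! ### Elementary operations on subsolutions -/

lemma gradient_eq_zero_of_isLocalMax_const_sub {φ : Space N → ℝ} {x : Space N} {k : ℝ}
    (h : IsLocalMax (fun y => k - φ y) x) : gradient φ x = 0 := by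
  have h1 : IsLocalMin φ x := by
    filter_upwards [h] with y hy
    linarith
  rw [gradient, h1.fderiv_eq_zero, map_zero]

lemma gradient_eq_of_isLocalMax_sub {ψ φ : Space N → ℝ} {x : Space N}
    (hψ : DifferentiableAt ℝ ψ x) (hφ : DifferentiableAt ℝ φ x)
    (h : IsLocalMax (fun y => ψ y - φ y) x) : gradient φ x = gradient ψ x := by
  have h1 := h.fderiv_eq_zero
  rw [fderiv_fun_sub hψ hφ, sub_eq_zero] at h1
  rw [gradient, gradient, h1]

/-- Touching the larger of two functions from above. -/
lemma isLocalMax_sub_of_le {v w φ : Space N → ℝ} {x : Space N} (hle : ∀ᶠ y in 𝓝 x, v y ≤ w y)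
    (heq : w x ≤ v x) (h : IsLocalMax (fun y => w y - φ y) x) :
    IsLocalMax (fun y => v y - φ y) x := by
  filter_upwards [h, hle] with y hy hy'
  linarith

lemma isSubsolution_const {H : Space N → Space N → ℝ} {lam a k : ℝ}
    (h : ∀ x, lam * k + H x 0 ≤ a) : IsSubsolution H lam a fun _ => k := by
  refine ⟨continuous_const.upperSemicontinuous, fun x φ _ hmax => ?_⟩
  rw [gradient_eq_zero_of_isLocalMax_const_sub hmax]
  exact h x

/-- The maximum of a function with a constant is a subsolution as soon as each of them is one
at the points where it realizes the maximum. -/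
lemma isSubsolution_max_const {H : Space N → Space N → ℝ} {lam a k : ℝ} {v : Space N → ℝ}
    (hv : UpperSemicontinuous v)
    (hsub : ∀ (x : Space N) (φ : Space N → ℝ), ContDiffAt ℝ 1 φ x →
      IsLocalMax (fun y => v y - φ y) x → k ≤ v x → lam * v x + H x (gradient φ x) ≤ a)
    (hk : ∀ x, v x < k → lam * k + H x 0 ≤ a) :
    IsSubsolution H lam a fun y => max (v y) k := by
  refine ⟨hv.sup continuous_const.upperSemicontinuous, fun x φ hφ hmax => ?_⟩
  beta_reduce
  rcases le_or_gt k (v x) with hx | hx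
  · rw [max_eq_left hx]
    exact hsub x φ hφ (isLocalMax_sub_of_le (.of_forall fun y => le_max_left _ _)
      (max_eq_left hx).le hmax) hx
  · have h1 := isLocalMax_sub_of_le (v := fun _ => k) (.of_forall fun y => le_max_right _ _)
      (max_eq_right hx.le).le hmax
    rw [gradient_eq_zero_of_isLocalMax_const_sub h1, max_eq_right hx.le]
    exact hk x hx

lemma IsSubsolution.sub_const {H : Space N → Space N → ℝ} {lam a : ℝ} {v : Space N → ℝ}
    (hv : IsSubsolution H lam a v) (k : ℝ) :
    IsSubsolution H lam (a - lam * k) fun y => v y - k := by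
  refine ⟨?_, fun x φ hφ hmax => ?_⟩
  · simp only [sub_eq_add_neg]
    exact hv.1.add continuous_const.upperSemicontinuous
  · have := hv.2 x φ hφ (by filter_upwards [hmax] with y hy; linarith)
    linarith

/-- Lowering a bounded subsolution of the undiscounted equation. -/
lemma IsSubsolution.discount {H : Space N → Space N → ℝ} {lam a b : ℝ} {v : Space N → ℝ}
    (hv : IsSubsolution H 0 a v) (hb : ∀ x, lam * v x + a ≤ b) : IsSubsolution H lam b v :=
  ⟨hv.1, fun x φ hφ hmax => by linarith [hv.2 x φ hφ hmax, hb x]⟩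

lemma IsSubsolution.undiscount {H : Space N → Space N → ℝ} {lam a b : ℝ} {v : Space N → ℝ}
    (hv : IsSubsolution H lam a v) (hb : ∀ x, a ≤ lam * v x + b) : IsSubsolution H 0 b v :=
  ⟨hv.1, fun x φ hφ hmax => by linarith [hv.2 x φ hφ hmax, hb x]⟩

/-- Equi-Lipschitz continuity of subsolutions on balls. -/
lemma HamCoercive.exists_lipschitz {H : Space N → Space N → ℝ} (hcoer : HamCoercive H) {R : ℝ}
    (hR : 0 < R) (a : ℝ) :
    ∃ L : ℝ, 0 ≤ L ∧ ∀ u, IsSubsolution H 0 a u → ∀ x y, ‖x‖ < R → ‖y‖ < R →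
      u y ≤ u x + L * ‖y - x‖ := by
  obtain ⟨L, hL, h⟩ := hcoer.exists_norm_le (R := 3 * R) (by linarith) a
  refine ⟨L, hL, fun u hu x y hx hy => ?_⟩
  refine le_add_of_gradient_bound (r := 2 * R) hu.1 hL (fun z hz φ hφ hmax => ?_) ?_
  · refine h z _ ?_ (by simpa using hu.2 z φ hφ hmax)
    have := norm_add_le (z - x) x
    rw [sub_add_cancel] at this
    linarith
  · linarith [norm_sub_le y x]

/-- Levels that admit subsolutions lie above every minimum `min_p H(x₀, p)`. -/
lemma IsSubsolution.le_level {H : Space N → Space N → ℝ} (hcont : HamContinuous H)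
    (hcoer : HamCoercive H) {x₀ : Space N} {a b : ℝ} (hb : ∀ p, b ≤ H x₀ p) {u : Space N → ℝ}
    (hu : IsSubsolution H 0 a u) : b ≤ a := by
  by_contra! hab
  obtain ⟨L, -, hL⟩ := hcoer.exists_norm_le (R := ‖x₀‖ + 1) (by positivity) a
  -- Gradients of test functions near `x₀` would lie in a compact ball of momenta, on which `H > a`
  -- persists near `x₀`.
  have hev : ∀ᶠ y in 𝓝 x₀, ∀ p ∈ Metric.closedBall (0 : Space N) L, a < H y p := by
    refine (isCompact_closedBall (0 : Space N) L).eventually_forall_of_forall_eventually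
      fun p _ => ?_
    exact hcont.continuousAt.eventually (lt_mem_nhds (hab.trans_le (hb p)))
  obtain ⟨r, hr, hball⟩ := Metric.eventually_nhds_iff_ball.1 hev
  obtain ⟨y, hy, φ, hφ, hmax⟩ := exists_touching hu.1 x₀ (lt_min hr one_pos)
  have h1 : H y (gradient φ y) ≤ a := by simpa using hu.2 y φ hφ hmax
  have hy1 : ‖y‖ < ‖x₀‖ + 1 := by
    have := norm_add_le (y - x₀) x₀
    rw [sub_add_cancel] at this
    linarith [hy.trans_le (min_le_right r 1)]
  have h2 := hball y (by rw [mem_ball_iff_norm]; exact hy.trans_le (min_le_left r 1)) (gradient φ y)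
    (by simpa using hL y _ hy1 h1)
  linarith

/-! ### Compression of subsolutions -/

/-- A concave compression of the positive half-line into `[0, 1)`. -/
noncomputable def compress (t : ℝ) : ℝ := t / (1 + max t 0)

lemma compress_of_nonpos {t : ℝ} (ht : t ≤ 0) : compress t = t := by simp [compress, ht]

lemma compress_of_nonneg {t : ℝ} (ht : 0 ≤ t) : compress t = t / (1 + t) := by simp [compress, ht]

lemma continuous_compress : Continuous compress :=
  continuous_id.div (by fun_prop) fun t => by positivity

lemma compress_lt_one (t : ℝ) : compress t < 1 := by
  rw [compress, div_lt_one (by positivity)]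
  linarith [le_max_left t 0]

/-- On the positive side `s / (1 - s)` is the inverse; on the negative side it still dominates `s`,
the difference being `s ^ 2 / (1 - s)`. -/
lemma le_of_compress_le {t s : ℝ} (hs : s < 1) (h : compress t ≤ s) : t ≤ s / (1 - s) := by
  rw [le_div_iff₀ (by linarith)]
  rcases le_total t 0 with ht | ht
  · rw [compress_of_nonpos ht] at h
    nlinarith [mul_nonneg (sub_nonneg.2 h) (sub_nonneg.2 hs.le), sq_nonneg s]
  · rw [compress_of_nonneg ht, div_le_iff₀ (by linarith)] at h
    linarith

lemma monotone_compress : Monotone compress := by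
  intro s t hst
  by_contra! h
  have h1 := le_of_compress_le (compress_lt_one s) h.le
  rcases le_total s 0 with hs | hs
  · rcases le_total t 0 with ht | ht
    · rw [compress_of_nonpos hs, compress_of_nonpos ht] at h
      linarith
    · rw [compress_of_nonpos hs, compress_of_nonneg ht] at h
      have : 0 ≤ t / (1 + t) := by positivity
      linarith
  · have ht := hs.trans hst
    rw [compress_of_nonneg hs, compress_of_nonneg ht, div_lt_div_iff₀ (by linarith) (by linarith)]
      at h
    linarith

/-- Compressing a subsolution where it is positive, provided constants are subsolutions there. -/
lemma IsSubsolution.compress {H : Space N → Space N → ℝ} (hconv : HamConvex H) {a : ℝ}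
    {w : Space N → ℝ} (hw : IsSubsolution H 0 a w) (h0 : ∀ x, 0 < w x → H x 0 ≤ a) :
    IsSubsolution H 0 a fun y => compress (w y) := by
  refine ⟨continuous_compress.comp_upperSemicontinuous hw.1 monotone_compress,
    fun x φ hφ hmax => ?_⟩
  rw [zero_mul, zero_add]
  set s := DiscountedHJ.compress (w x) with hs
  set f : Space N → ℝ := fun y => φ y - φ x + s with hf
  have hfx : f x = s := by simp [hf]
  have hfc : ContDiffAt ℝ 1 f x := (hφ.sub contDiffAt_const).add contDiffAt_const
  have hle : ∀ᶠ y in 𝓝 x, DiscountedHJ.compress (w y) ≤ f y := by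
    filter_upwards [hmax] with y hy
    simp only [hf]
    linarith
  rcases lt_or_ge (w x) 0 with hx | hx
  · have hsx : s = w x := compress_of_nonpos hx.le
    -- A negative `f` forces `w ≤ 0` nearby, where the compression is the identity.
    have hneg : ∀ᶠ y in 𝓝 x, f y < 0 :=
      hfc.continuousAt.eventually (gt_mem_nhds (by rw [hfx, hsx]; exact hx))
    have := hw.2 x φ hφ (by
      filter_upwards [hle, hneg] with y h1 h2
      have hwy : w y ≤ 0 := by
        by_contra! hwy
        rw [compress_of_nonneg hwy.le] at h1
        have : 0 < w y / (1 + w y) := by positivity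
        linarith
      rw [compress_of_nonpos hwy] at h1
      simp only [hf] at h1
      linarith)
    simpa using this
  · have hs1 : s < 1 := compress_lt_one _
    have hsx : s = w x / (1 + w x) := compress_of_nonneg hx
    have hs2 : 1 - s = (1 + w x)⁻¹ := by rw [hsx]; field_simp; ring
    have hlt : ∀ᶠ y in 𝓝 x, f y < 1 :=
      hfc.continuousAt.eventually (gt_mem_nhds (by rw [hfx]; exact hs1))
    have hne : (1 : ℝ) - f x ≠ 0 := by rw [hfx]; linarith
    -- Inverting the compression turns a test function for `compress ∘ w` into one for `w`, with
    -- gradient multiplied by `(1 + w x) ^ 2`.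
    have hgc : ContDiffAt ℝ 1 (fun y => f y / (1 - f y)) x :=
      hfc.div (contDiffAt_const.sub hfc) hne
    have hgrad : gradient (fun y => f y / (1 - f y)) x = (1 + w x) ^ 2 • gradient φ x := by
      have hφd : HasFDerivAt f (fderiv ℝ φ x) x :=
        (((hφ.differentiableAt one_ne_zero).hasFDerivAt).sub_const _).add_const _
      have hd : HasDerivAt (fun t : ℝ => t / (1 - t)) ((1 + w x) ^ 2) (f x) := by
        have := (hasDerivAt_id (f x)).div ((hasDerivAt_id (f x)).const_sub 1) hne
        refine this.congr_deriv ?_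
        rw [hfx]
        simp only [id, hs2]
        field_simp
        rw [hsx]
        field_simp
        ring
      have h1 := (hd.comp_hasFDerivAt x hφd).fderiv
      rw [show ((fun t : ℝ => t / (1 - t)) ∘ f) = fun y => f y / (1 - f y) from rfl] at h1
      rw [gradient, h1, map_smul]
      rfl
    have hfin := hw.2 x _ hgc (by
      filter_upwards [hle, hlt] with y h1 h2
      have h3 := le_of_compress_le h2 h1
      have h4 : f x / (1 - f x) = w x := by
        rw [hfx, hs2, hsx]
        field_simp
      linarith)
    rw [zero_mul, zero_add, hgrad] at hfin
    rcases hx.eq_or_lt with hx0 | hx0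
    · simpa [← hx0] using hfin
    · have hpos : (0 : ℝ) < (1 + w x) ^ 2 := by positivity
      have hle1 : ((1 + w x) ^ 2)⁻¹ ≤ 1 := inv_le_one_of_one_le₀ (by nlinarith)
      -- `gradient φ x` is a convex combination of the enlarged gradient and `0`, both admissible at
      -- level `a`.
      have hc := (hconv x).2 (mem_univ ((1 + w x) ^ 2 • gradient φ x)) (mem_univ 0)
        (inv_pos.2 hpos).le (sub_nonneg.2 hle1) (by ring)
      rw [smul_zero, add_zero, smul_smul, inv_mul_cancel₀ hpos.ne', one_smul] at hc
      have h5 := h0 x hx0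
      have h6 := mul_le_mul_of_nonneg_left hfin (inv_pos.2 hpos).le
      have h7 := mul_le_mul_of_nonneg_left h5 (sub_nonneg.2 hle1)
      simp only [smul_eq_mul] at hc
      linarith

/-! ### Perron's method -/

/-- The values at `x` of the subsolutions bounded from below by `k`. -/
def subsolutionValues (H : Space N → Space N → ℝ) (lam a k : ℝ) (x : Space N) : Set ℝ :=
  {t | ∃ v, IsSubsolution H lam a v ∧ (∀ y, k ≤ v y) ∧ v x = t}

lemma continuousAt_gradient {φ : Space N → ℝ} {x : Space N} (hφ : ContDiffAt ℝ 1 φ x) :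
    ContinuousAt (gradient φ) x :=
  (InnerProductSpace.toDual ℝ (Space N)).symm.continuous.continuousAt.comp
    (hφ.continuousAt_fderiv one_ne_zero)

lemma gradient_add_mul_norm_sq {φ : Space N → ℝ} {y : Space N} (hφ : DifferentiableAt ℝ φ y)
    (x : Space N) (A : ℝ) :
    gradient (fun z => φ z + A * ‖z - x‖ ^ 2) y = gradient φ y + (2 * A) • (y - x) := by
  have h1 : HasFDerivAt (fun z : Space N => ‖z - x‖ ^ 2) (2 • (innerSL ℝ (y - x))) y :=
    (hasStrictFDerivAt_norm_sq (y - x)).hasFDerivAt.comp (f := fun z : Space N => z - x) y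
      ((hasFDerivAt_id y).sub_const x)
  have h2 : HasGradientAt (fun z => φ z + A * ‖z - x‖ ^ 2) (gradient φ y + (2 * A) • (y - x)) y := by
    rw [hasGradientAt_iff_hasFDerivAt]
    refine (hφ.hasFDerivAt.add (h1.const_mul A)).congr_fderiv ?_
    ext z
    simp
    ring
  exact h2.gradient

lemma eventually_contDiffAt {φ : Space N → ℝ} {x : Space N} (hφ : ContDiffAt ℝ 1 φ x) :
    ∀ᶠ y in 𝓝 x, ContDiffAt ℝ 1 φ y :=
  hφ.eventually (by simp)

lemma continuousAt_ham_gradient {H : Space N → Space N → ℝ} (hcont : HamContinuous H)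
    {φ : Space N → ℝ} {x : Space N} (hφ : ContDiffAt ℝ 1 φ x) (A : ℝ) :
    ContinuousAt (fun y => H y (gradient φ y + A • (y - x))) x := by
  have h1 : ContinuousAt (fun y : Space N => A • (y - x)) x :=
    Continuous.continuousAt (by fun_prop)
  exact ContinuousAt.comp (f := fun y => (y, gradient φ y + A • (y - x)))
    (g := fun z : Space N × Space N => H z.1 z.2) hcont.continuousAt
    (continuousAt_id.prodMk ((continuousAt_gradient hφ).add h1))

/-- The supremum of a family of subsolutions is a subsolution if it is upper semicontinuous. -/
lemma isSubsolution_of_isLUB {H : Space N → Space N → ℝ} (hcont : HamContinuous H) {lam a k : ℝ}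
    (hlam : 0 < lam) {u : Space N → ℝ} (hu : UpperSemicontinuous u)
    (hlub : ∀ x, IsLUB (subsolutionValues H lam a k x) (u x)) : IsSubsolution H lam a u := by
  refine ⟨hu, fun x φ hφ hmax => ?_⟩
  by_contra! hlt
  -- The first coordinate is the loss from replacing `u` by a nearly optimal `v`; the extra gradient
  -- term comes from the quadratic penalty.
  set F : ℝ × Space N → ℝ := fun z =>
    lam * (φ z.2 + u x - φ x - z.1) + H z.2 (gradient φ z.2 + (2 * (1 : ℝ)) • (z.2 - x)) with hF
  have hFc : ContinuousAt F (0, x) := by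
    have hφc : ContinuousAt (fun z : ℝ × Space N => φ z.2) (0, x) :=
      ContinuousAt.comp (f := Prod.snd) (g := φ) hφ.continuousAt continuousAt_snd
    have hgc : ContinuousAt (fun z : ℝ × Space N =>
        H z.2 (gradient φ z.2 + (2 * (1 : ℝ)) • (z.2 - x))) (0, x) :=
      ContinuousAt.comp (f := Prod.snd)
        (g := fun y => H y (gradient φ y + (2 * (1 : ℝ)) • (y - x)))
        (continuousAt_ham_gradient hcont hφ _) continuousAt_snd
    exact (continuousAt_const.mul (((hφc.add continuousAt_const).sub continuousAt_const).sub
      continuousAt_fst)).add hgc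
  have hF0 : a < F (0, x) := by simpa [hF] using hlt
  have hev := hFc.eventually (lt_mem_nhds hF0)
  obtain ⟨r₁, hr₁, hball₁⟩ := Metric.eventually_nhds_iff_ball.1 hev
  obtain ⟨r₂, hr₂, hball₂⟩ :=
    Metric.eventually_nhds_iff_ball.1 (hmax.and (eventually_contDiffAt hφ))
  obtain ⟨r, hr, hr12⟩ := exists_between (lt_min (lt_min hr₁ hr₂) one_pos)
  have hrr₁ : r < r₁ := hr12.trans_le ((min_le_left _ _).trans (min_le_left _ _))
  have hrr₂ : r < r₂ := hr12.trans_le ((min_le_left _ _).trans (min_le_right _ _))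
  have hr1 : r < 1 := hr12.trans_le (min_le_right _ _)
  have hmem : ∀ y, ‖y - x‖ ≤ r → y ∈ Metric.ball x r₂ := fun y hy => by
    rw [mem_ball_iff_norm]
    linarith
  -- The gap `r ^ 2` is the size of the penalty on the sphere, so the maximum of `v` minus the test
  -- function stays inside.
  obtain ⟨_, ⟨v, hv, hkv, rfl⟩, hvx, -⟩ :=
    (hlub x).exists_between (show u x - r ^ 2 < u x by linarith [pow_pos hr 2])
  have hvu : ∀ y, v y ≤ u y := fun y => (hlub y).1 ⟨v, hv, hkv, rfl⟩
  have hcd : ∀ y, ‖y - x‖ ≤ r → ContDiffAt ℝ 1 (fun z => φ z + 1 * ‖z - x‖ ^ 2) y := fun y hy =>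
    (hball₂ y (hmem y hy)).2.add
      (contDiff_const.mul ((contDiff_id.sub contDiff_const).norm_sq ℝ)).contDiffAt
  obtain ⟨y, hy, hge, hloc⟩ := exists_max_in_ball (φ := fun z => φ z + 1 * ‖z - x‖ ^ 2) hv.1 hr
    (fun y hy => (hcd y (by rwa [mem_closedBall_iff_norm] at hy)).continuousAt.continuousWithinAt)
    (fun y hy => by
      have h1 : u y - φ y ≤ u x - φ x := (hball₂ y (hmem y hy.le)).1
      have h2 := hvu y
      simp only [hy, sub_self, norm_zero]
      linarith)
  have h1 := hv.2 y _ (hcd y hy.le) hloc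
  rw [gradient_add_mul_norm_sq ((hball₂ y (hmem y hy.le)).2.differentiableAt one_ne_zero)] at h1
  have h2 := hge x (by simpa using hr.le)
  simp only [sub_self, norm_zero] at h2
  have h3 : a < F (r ^ 2, y) := by
    refine hball₁ _ ?_
    rw [Metric.mem_ball, Prod.dist_eq, max_lt_iff]
    constructor
    · rw [Real.dist_eq, sub_zero, abs_of_pos (pow_pos hr 2)]
      nlinarith
    · rw [dist_eq_norm]
      exact hy.trans hrr₁
  simp only [hF] at h3
  have h4 : φ y + u x - φ x - r ^ 2 ≤ v y := by nlinarith [sq_nonneg ‖y - x‖]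
  have h5 := mul_le_mul_of_nonneg_left h4 hlam.le
  linarith

/-- The supremum of a family of subsolutions is a supersolution, by the bump construction. -/
lemma isSupersolution_of_isLUB {H : Space N → Space N → ℝ} (hcont : HamContinuous H)
    {lam a k : ℝ} {u : Space N → ℝ} (hu : Continuous u) (hk : ∀ x, k ≤ u x)
    (hsub : IsSubsolution H lam a u)
    (hlub : ∀ x, IsLUB (subsolutionValues H lam a k x) (u x)) : IsSupersolution H lam a u := by
  refine ⟨hu.lowerSemicontinuous, fun x φ hφ hmin => ?_⟩
  by_contra! hlt
  set F : ℝ × Space N → ℝ := fun z =>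
    lam * (φ z.2 + -1 * ‖z.2 - x‖ ^ 2 + (u x - φ x + z.1)) +
      H z.2 (gradient φ z.2 + (2 * (-1 : ℝ)) • (z.2 - x)) with hF
  have hFc : ContinuousAt F (0, x) := by
    have hφc : ContinuousAt (fun z : ℝ × Space N => φ z.2) (0, x) :=
      ContinuousAt.comp (f := Prod.snd) (g := φ) hφ.continuousAt continuousAt_snd
    have hgc : ContinuousAt (fun z : ℝ × Space N =>
        H z.2 (gradient φ z.2 + (2 * (-1 : ℝ)) • (z.2 - x))) (0, x) :=
      ContinuousAt.comp (f := Prod.snd)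
        (g := fun y => H y (gradient φ y + (2 * (-1 : ℝ)) • (y - x)))
        (continuousAt_ham_gradient hcont hφ _) continuousAt_snd
    have hq : ContinuousAt (fun z : ℝ × Space N => -1 * ‖z.2 - x‖ ^ 2) (0, x) :=
      Continuous.continuousAt (by fun_prop)
    exact (continuousAt_const.mul ((hφc.add hq).add (continuousAt_const.add continuousAt_fst))).add
      hgc
  have hF0 : F (0, x) < a := by simpa [hF] using hlt
  obtain ⟨r₁, hr₁, hball₁⟩ :=
    Metric.eventually_nhds_iff_ball.1 (hFc.eventually (gt_mem_nhds hF0))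
  obtain ⟨r₂, hr₂, hball₂⟩ :=
    Metric.eventually_nhds_iff_ball.1 (hmin.and (eventually_contDiffAt hφ))
  obtain ⟨r, hr, hr12⟩ := exists_between (lt_min (lt_min hr₁ hr₂) one_pos)
  have hrr₁ : r < r₁ := hr12.trans_le ((min_le_left _ _).trans (min_le_left _ _))
  have hrr₂ : r < r₂ := hr12.trans_le ((min_le_left _ _).trans (min_le_right _ _))
  have hr1 : r < 1 := hr12.trans_le (min_le_right _ _)
  -- With this height the bump `ψ` lies below `u` beyond radius `r / 2`, so gluing at radius `r` is
  -- continuous, while at `x` it exceeds `u` by `δ`.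
  set δ := (r / 2) ^ 2 with hδ
  have hδ0 : 0 < δ := by positivity
  have hδr : δ < r₁ := by rw [hδ]; nlinarith
  set ψ : Space N → ℝ := fun z => φ z + -1 * ‖z - x‖ ^ 2 + (u x - φ x + δ) with hψ
  have hcd : ∀ y, ‖y - x‖ < r → ContDiffAt ℝ 1 ψ y := fun y hy =>
    ((hball₂ y (by rw [mem_ball_iff_norm]; linarith)).2.add
      (contDiff_const.mul ((contDiff_id.sub contDiff_const).norm_sq ℝ)).contDiffAt).add
      contDiffAt_const
  have hψu : ∀ y, r / 2 < ‖y - x‖ → ‖y - x‖ < r → ψ y ≤ u y := fun y hy1 hy2 => by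
    have h1 : u x - φ x ≤ u y - φ y := (hball₂ y (by rw [mem_ball_iff_norm]; linarith)).1
    have h2 : δ ≤ ‖y - x‖ ^ 2 := pow_le_pow_left₀ (by positivity) hy1.le 2
    simp only [hψ]
    linarith
  classical
  set w : Space N → ℝ := fun z => if ‖z - x‖ < r then max (u z) (ψ z) else u z with hw
  have huw : ∀ y, u y ≤ w y := fun y => by
    simp only [hw]
    split_ifs
    exacts [le_max_left _ _, le_rfl]
  have hin : ∀ y, ‖y - x‖ < r → ∀ᶠ z in 𝓝 y, ‖z - x‖ < r := fun y hy =>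
    (Continuous.continuousAt (by fun_prop : Continuous fun z : Space N => ‖z - x‖)).eventually
      (gt_mem_nhds hy)
  have hwc : Continuous w := by
    refine continuous_iff_continuousAt.2 fun y => ?_
    rcases lt_or_ge ‖y - x‖ r with hy | hy
    · have hmc : ContinuousAt (fun z => max (u z) (ψ z)) y :=
        hu.continuousAt.max (hcd y hy).continuousAt
      refine hmc.congr ?_
      filter_upwards [hin y hy] with z hz
      simp [hw, hz]
    · refine hu.continuousAt.congr ?_
      have hev : ∀ᶠ z in 𝓝 y, r / 2 < ‖z - x‖ :=
        (Continuous.continuousAt (by fun_prop : Continuous fun z : Space N => ‖z - x‖)).eventually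
          (lt_mem_nhds (by linarith))
      filter_upwards [hev] with z hz
      simp only [hw]
      split_ifs with h
      · rw [max_eq_left (hψu z hz h)]
      · rfl
  have hws : IsSubsolution H lam a w := by
    refine ⟨hwc.upperSemicontinuous, fun y f hf hmax => ?_⟩
    rcases le_or_gt (w y) (u y) with hy | hy
    · rw [le_antisymm hy (huw y)]
      exact hsub.2 y f hf (isLocalMax_sub_of_le (.of_forall huw) hy hmax)
    · have hyr : ‖y - x‖ < r := by
        by_contra h
        simp [hw, h] at hy
      have hwy : w y = ψ y := by
        simp only [hw, if_pos hyr] at hy ⊢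
        exact max_eq_right (by
          by_contra! h
          rw [max_eq_left h.le] at hy
          exact lt_irrefl _ hy)
      have h1 : IsLocalMax (fun z => ψ z - f z) y := by
        refine isLocalMax_sub_of_le ?_ hwy.le hmax
        filter_upwards [hin y hyr] with z hz
        simp [hw, hz]
      have h2 : gradient f y = gradient φ y + (2 * (-1 : ℝ)) • (y - x) := by
        rw [gradient_eq_of_isLocalMax_sub ((hcd y hyr).differentiableAt one_ne_zero)
          (hf.differentiableAt one_ne_zero) h1]
        rw [← gradient_add_mul_norm_sq
          ((hball₂ y (by rw [mem_ball_iff_norm]; linarith)).2.differentiableAt one_ne_zero)]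
        simp only [gradient, hψ, fderiv_add_const]
      rw [hwy, h2]
      refine (hball₁ (δ, y) ?_).le
      rw [Metric.mem_ball, Prod.dist_eq, max_lt_iff]
      constructor
      · rwa [Real.dist_eq, sub_zero, abs_of_pos hδ0]
      · rw [dist_eq_norm]
        exact hyr.trans hrr₁
  have hwx : w x ≤ u x := (hlub x).1 ⟨w, hws, fun y => (hk y).trans (huw y), rfl⟩
  have hwx' : ψ x ≤ w x := by simp [hw, hr]
  have : ψ x = u x + δ := by simp [hψ]; ring
  linarith

/-! ### The critical value and uniform bounds -/

lemma le_criticalValue {H : Space N → Space N → ℝ} (hcont : HamContinuous H)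
    (hcoer : HamCoercive H) {C b : ℝ} {x₀ : Space N} (hC : ∀ x, H x 0 ≤ C)
    (hb : ∀ p, b ≤ H x₀ p) : b ≤ criticalValue H :=
  le_csInf ⟨C, _, isSubsolution_const (k := 0) fun x => by simpa using hC x⟩
    fun _ ⟨_, hu⟩ => hu.le_level hcont hcoer hb

lemma criticalValue_le {H : Space N → Space N → ℝ} (hcont : HamContinuous H)
    (hcoer : HamCoercive H) {b : ℝ} {x₀ : Space N} (hb : ∀ p, b ≤ H x₀ p) {a : ℝ}
    {u : Space N → ℝ} (hu : IsSubsolution H 0 a u) : criticalValue H ≤ a :=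
  csInf_le ⟨b, fun _ ⟨_, hu⟩ => hu.le_level hcont hcoer hb⟩ ⟨u, hu⟩

/-- Levels strictly above `c` suffice later, so attainment of the infimum is never needed. -/
lemma exists_subsolution_of_criticalValue_lt {H : Space N → Space N → ℝ} {C a : ℝ}
    (hC : ∀ x, H x 0 ≤ C) (ha : criticalValue H < a) : ∃ u, IsSubsolution H 0 a u := by
  have hne : {a : ℝ | ∃ u : Space N → ℝ, IsSubsolution H 0 a u}.Nonempty :=
    ⟨C, _, isSubsolution_const (k := 0) fun x => by simpa using hC x⟩
  obtain ⟨a', ⟨u, hu⟩, ha'⟩ := exists_lt_of_csInf_lt hne ha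
  exact ⟨u, hu.undiscount fun x => by linarith⟩

/-- Subsolutions above the critical level that are bounded independently of the level. -/
lemma exists_bounded_subsolution {H : Space N → Space N → ℝ} (hconv : HamConvex H)
    (hcoer : HamCoercive H) {R a C : ℝ} (hR : 0 < R) (hout : ∀ x, R < ‖x‖ → H x 0 ≤ a)
    (ha : a ≤ criticalValue H) (hC : ∀ x, H x 0 ≤ C) :
    ∃ K : ℝ, ∀ η, 0 < η → η ≤ 1 → ∃ v, IsSubsolution H 0 (criticalValue H + η) v ∧
      ∀ x, -K ≤ v x ∧ v x ≤ 1 := by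
  -- Level `c + 1` covers every `η ≤ 1`, which makes the bound independent of `η`.
  obtain ⟨L, hL, hLip⟩ := hcoer.exists_lipschitz (R := R + 1) (by linarith) (criticalValue H + 1)
  refine ⟨L * (2 * R), fun η hη hη1 => ?_⟩
  obtain ⟨w, hw⟩ := exists_subsolution_of_criticalValue_lt hC (lt_add_of_pos_right _ hη)
  obtain ⟨z, hz, hzmax⟩ := (hw.1.upperSemicontinuousOn _).exists_isMaxOn
    ⟨0, Metric.mem_closedBall_self hR.le⟩ (isCompact_closedBall (0 : Space N) R)
  have hzR : ‖z‖ ≤ R := by simpa using hz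
  have hw' : IsSubsolution H 0 (criticalValue H + η) fun y => w y - w z := by
    simpa using hw.sub_const (w z)
  have hnonpos : ∀ x, ‖x‖ ≤ R → w x - w z ≤ 0 := fun x hx =>
    sub_nonpos.2 (hzmax (by simpa using hx))
  have hge : ∀ x, ‖x‖ ≤ R → -(L * (2 * R)) ≤ w x - w z := fun x hx => by
    have h1 := hLip w (hw.undiscount fun y => by linarith) x z (by linarith) (by linarith)
    have h2 : L * ‖z - x‖ ≤ L * (2 * R) :=
      mul_le_mul_of_nonneg_left (by linarith [norm_sub_le z x]) hL
    linarith
  have hc := hw'.compress hconv fun x hx => by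
    have : R < ‖x‖ := by
      by_contra! h
      exact absurd hx (not_lt.2 (hnonpos x h))
    linarith [hout x this]
  refine ⟨_, isSubsolution_max_const (k := -(L * (2 * R))) hc.1
    (fun x φ hφ hmax _ => hc.2 x φ hφ hmax) fun x hx => ?_, fun x => ⟨le_max_right _ _, ?_⟩⟩
  · have : R < ‖x‖ := by
      by_contra! h
      rw [compress_of_nonpos (hnonpos x h)] at hx
      exact absurd hx (not_lt.2 (hge x h))
    linarith [hout x this]
  · refine max_le (compress_lt_one _).le ?_
    have : 0 ≤ L * (2 * R) := by positivity
    linarith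

/-- A continuous subsolution of the discounted equation at the critical level is nonpositive
somewhere in the ball outside of which constants are strict subsolutions. -/
lemma IsSubsolution.exists_nonpos {H : Space N → Space N → ℝ} (hcont : HamContinuous H)
    (hcoer : HamCoercive H) {R a b lam : ℝ} {x₀ : Space N} (hR : 0 < R)
    (hout : ∀ x, R < ‖x‖ → H x 0 ≤ a) (ha : a < criticalValue H) (hb : ∀ p, b ≤ H x₀ p)
    (hlam : 0 < lam) {v : Space N → ℝ} (hv : IsSubsolution H lam (criticalValue H) v)
    (hvc : ContinuousOn v (Metric.closedBall 0 R)) : ∃ x, ‖x‖ ≤ R ∧ v x ≤ 0 := by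
  obtain ⟨z, hz, hzmin⟩ := (isCompact_closedBall (0 : Space N) R).exists_isMinOn
    ⟨0, Metric.mem_closedBall_self hR.le⟩ hvc
  refine ⟨z, by simpa using hz, ?_⟩
  by_contra! hpos
  -- Where `v ≥ v z / 2` the discount term lowers the level; the constant takes over only outside
  -- the ball, where `a < c`.
  have hsub : IsSubsolution H 0 (max a (criticalValue H - lam * (v z / 2)))
      fun y => max (v y) (v z / 2) := by
    refine isSubsolution_max_const hv.1 (fun x φ hφ hmax hx => ?_) fun x hx => ?_
    · have h1 := hv.2 x φ hφ hmax
      have h2 := mul_le_mul_of_nonneg_left hx hlam.le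
      refine le_trans ?_ (le_max_right _ _)
      linarith
    · have : R < ‖x‖ := by
        by_contra! h
        have h3 : v z ≤ v x := hzmin (by simpa using h)
        linarith
      refine le_trans ?_ (le_max_left _ _)
      linarith [hout x this]
  have h1 := criticalValue_le hcont hcoer hb hsub
  have h2 : 0 < lam * (v z / 2) := by positivity
  rcases le_max_iff.1 h1 with h | h <;> linarith

lemma lipschitzOnWith_ball {u : Space N → ℝ} {R L : ℝ}
    (h : ∀ x y, ‖x‖ < R → ‖y‖ < R → u y ≤ u x + L * ‖y - x‖) :
    LipschitzOnWith (Real.toNNReal L) u (Metric.ball 0 R) :=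
  LipschitzOnWith.of_le_add_mul' L fun y hy z hz => by
    rw [dist_eq_norm]
    exact h z y (by simpa using hz) (by simpa using hy)

/-! ### Maximal solutions and compactness -/

/-- Maximal solutions of the discounted equations, with bounds that do not depend on the
discount factor. -/
lemma exists_maximalSolution {H : Space N → Space N → ℝ} (hcont : HamContinuous H)
    (hconv : HamConvex H) (hcoer : HamCoercive H) (hinf : HamInfinity H) :
    ∃ m : ℝ, ∃ L B : ℝ → ℝ, ∀ lam, 0 < lam → ∃ u : Space N → ℝ,
      IsMaximalSolution H lam (criticalValue H) u ∧ (∀ x, m ≤ u x) ∧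
      ∀ R, 0 < R → (∀ x y, ‖x‖ < R → ‖y‖ < R → u y ≤ u x + L R * ‖y - x‖) ∧
        ∀ x, ‖x‖ < R → u x ≤ B R := by
  obtain ⟨R₀, a, b, x₀, hR₀, hab, hout, hb⟩ := hinf.exists_bounds
  obtain ⟨C₁, hC₁⟩ := hcont.exists_le_of_outside hout
  have hac : a < criticalValue H := hab.trans_le (le_criticalValue hcont hcoer hC₁ hb)
  obtain ⟨K, hKv⟩ := exists_bounded_subsolution hconv hcoer hR₀ hout hac.le hC₁
  set c := criticalValue H with hc
  set C := max 0 (C₁ - c) with hCdef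
  have hC0 : 0 ≤ C := le_max_left _ _
  have hCC : C₁ ≤ c + C := by linarith [le_max_right 0 (C₁ - c)]
  have hLex : ∀ R : ℝ, ∃ L : ℝ, 0 ≤ L ∧ (0 < R → ∀ u, IsSubsolution H 0 (c + C) u →
      ∀ x y, ‖x‖ < R → ‖y‖ < R → u y ≤ u x + L * ‖y - x‖) := fun R => by
    by_cases hR : 0 < R
    · obtain ⟨L, hL, h⟩ := hcoer.exists_lipschitz hR (c + C)
      exact ⟨L, hL, fun _ => h⟩
    · exact ⟨0, le_rfl, fun h => absurd h hR⟩
  choose L hL0 hL using hLex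
  -- A Lipschitz constant times a bound on the distance to a point of the `R₀`-ball where the
  -- subsolution is nonpositive.
  set B : ℝ → ℝ := fun R => L (R + R₀ + 1) * (2 * (R + R₀ + 1)) with hB
  refine ⟨-K - 1, L, B, fun lam hlam => ?_⟩
  have hund : ∀ v, IsSubsolution H lam c v → (∀ y, -(C / lam) ≤ v y) →
      IsSubsolution H 0 (c + C) v := fun v hv hkv => hv.undiscount fun x => by
    have h1 := mul_le_mul_of_nonneg_left (hkv x) hlam.le
    have h2 : lam * -(C / lam) = -C := by field_simp
    linarith
  have hlip : ∀ v, IsSubsolution H lam c v → (∀ y, -(C / lam) ≤ v y) → ∀ R, 0 < R →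
      ∀ x y, ‖x‖ < R → ‖y‖ < R → v y ≤ v x + L R * ‖y - x‖ := fun v hv hkv R hR =>
    hL R hR v (hund v hv hkv)
  have hcontOf : ∀ v : Space N → ℝ, (∀ R, 0 < R → ∀ x y, ‖x‖ < R → ‖y‖ < R →
      v y ≤ v x + L R * ‖y - x‖) → Continuous v := fun v h => by
    refine continuous_iff_continuousAt.2 fun x => ?_
    have hnhds : Metric.ball (0 : Space N) (‖x‖ + 1) ∈ 𝓝 x :=
      Metric.isOpen_ball.mem_nhds (by simp)
    exact (lipschitzOnWith_ball (h _ (by positivity))).continuousOn.continuousAt hnhds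
  have hbd : ∀ v, IsSubsolution H lam c v → (∀ y, -(C / lam) ≤ v y) → ∀ R, 0 < R →
      ∀ x, ‖x‖ < R → v x ≤ B R := fun v hv hkv R hR x hx => by
    obtain ⟨z, hz, hvz⟩ := hv.exists_nonpos hcont hcoer hR₀ hout hac hb hlam
      (hcontOf v (hlip v hv hkv)).continuousOn
    have h1 := hlip v hv hkv (R + R₀ + 1) (by linarith) z x (by linarith) (by linarith)
    have h2 : L (R + R₀ + 1) * ‖x - z‖ ≤ L (R + R₀ + 1) * (2 * (R + R₀ + 1)) :=
      mul_le_mul_of_nonneg_left (by linarith [norm_sub_le x z]) (hL0 _)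
    simp only [hB]
    linarith
  have hmaxk : ∀ v, IsSubsolution H lam c v →
      IsSubsolution H lam c fun y => max (v y) (-(C / lam)) := fun v hv => by
    refine isSubsolution_max_const hv.1 (fun x φ hφ hmax _ => hv.2 x φ hφ hmax) fun x _ => ?_
    have h2 : lam * -(C / lam) = -C := by field_simp
    linarith [hC₁ x]
  have hconst : IsSubsolution H lam c fun _ => -(C / lam) := isSubsolution_const fun x => by
    have h2 : lam * -(C / lam) = -C := by field_simp
    linarith [hC₁ x]
  set k := -(C / lam) with hk
  have hlub : ∀ x, IsLUB (subsolutionValues H lam c k x) (sSup (subsolutionValues H lam c k x)) :=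
    fun x => isLUB_csSup ⟨k, _, hconst, fun _ => le_rfl, rfl⟩
      ⟨B (‖x‖ + 1), by
        rintro _ ⟨v, hv, hkv, rfl⟩
        exact hbd v hv hkv _ (by positivity) x (by linarith)⟩
  set u : Space N → ℝ := fun x => sSup (subsolutionValues H lam c k x) with hu
  have hku : ∀ x, k ≤ u x := fun x => (hlub x).1 ⟨_, hconst, fun _ => le_rfl, rfl⟩
  have hlipu : ∀ R, 0 < R → ∀ x y, ‖x‖ < R → ‖y‖ < R → u y ≤ u x + L R * ‖y - x‖ :=
    fun R hR x y hx hy => (hlub y).2 (by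
      rintro _ ⟨v, hv, hkv, rfl⟩
      have h1 : v x ≤ u x := (hlub x).1 ⟨v, hv, hkv, rfl⟩
      linarith [hlip v hv hkv R hR x y hx hy])
  have huc : Continuous u := hcontOf u hlipu
  have hsub : IsSubsolution H lam c u :=
    isSubsolution_of_isLUB hcont hlam huc.upperSemicontinuous hlub
  have hmax : ∀ v, IsSubsolution H lam c v → ∀ x, v x ≤ u x := fun v hv x =>
    (le_max_left (v x) k).trans
      ((hlub x).1 ⟨_, hmaxk v hv, fun y => le_max_right _ _, rfl⟩)
  refine ⟨u, ⟨⟨hsub, isSupersolution_of_isLUB hcont huc hku hsub hlub⟩, hmax⟩, fun x => ?_,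
    fun R hR => ⟨hlipu R hR, fun x hx => (hlub x).2 ?_⟩⟩
  · have key : ∀ η : ℝ, 0 < η → η ≤ 1 → -K - 1 - η / lam ≤ u x := fun η hη hη1 => by
      obtain ⟨v, hv, hvb⟩ := hKv η hη hη1
      have h1 := hv.sub_const (1 + η / lam)
      rw [zero_mul, sub_zero] at h1
      -- Since `v ≤ 1`, the shift makes the discount term at most `-η`, absorbing the excess of the
      -- level over `c`.
      have h2 : IsSubsolution H lam c fun y => v y - (1 + η / lam) := h1.discount fun y => by
        have h3 := mul_le_mul_of_nonneg_left (hvb y).2 hlam.le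
        have h4 : lam * (η / lam) = η := by field_simp
        linarith
      linarith [hmax _ h2 x, (hvb x).1]
    have hlim : Tendsto (fun η : ℝ => -K - 1 - η / lam) (𝓝[>] 0) (𝓝 (-K - 1 - 0 / lam)) :=
      (Continuous.tendsto (by fun_prop) 0).mono_left nhdsWithin_le_nhds
    have := le_of_tendsto hlim (by
      filter_upwards [Ioc_mem_nhdsGT one_pos] with η hη
      exact key η hη.1 hη.2)
    simpa using this
  · rintro _ ⟨v, hv, hkv, rfl⟩
    exact hbd v hv hkv R hR x hx

/-- Locally equi-Lipschitz and locally equibounded families are relatively compact. -/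
lemma isCompact_closure_of_lipschitzOnWith {s : Set C(Space N, ℝ)} {L B m : ℝ → ℝ}
    (hlip : ∀ f ∈ s, ∀ R, 0 < R → LipschitzOnWith (Real.toNNReal (L R)) f (Metric.ball 0 R))
    (hbd : ∀ f ∈ s, ∀ R, 0 < R → ∀ x, ‖x‖ < R → f x ∈ Icc (m R) (B R)) :
    IsCompact (closure s) := by
  have : T2Space (UniformOnFun (Space N) ℝ {K | IsCompact K}) :=
    UniformOnFun.t2Space_of_covering sUnion_isCompact_eq_univ
  refine ArzelaAscoli.isCompact_closure_of_isClosedEmbedding (X := Space N) (α := ℝ)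
    (F := fun f : C(Space N, ℝ) => (f : Space N → ℝ)) (𝔖 := {K | IsCompact K}) (fun K hK => hK)
    ContinuousMap.isUniformEmbedding_toUniformOnFunIsCompact.isClosedEmbedding
    (fun K hK x hx => ?_) (fun K hK x hx => ?_)
  · refine EquicontinuousAt.equicontinuousWithinAt ?_ K
    have hball : Metric.ball (0 : Space N) (‖x‖ + 1) ∈ 𝓝 x :=
      Metric.isOpen_ball.mem_nhds (by simp)
    refine Metric.equicontinuousAt_of_continuity_modulus
      (fun y => Real.toNNReal (L (‖x‖ + 1)) * dist x y) ?_ _ ?_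
    · exact Continuous.tendsto' (by fun_prop) x 0 (by simp)
    · filter_upwards [hball] with y hy f
      exact (hlip f f.2 (‖x‖ + 1) (by positivity)).dist_le_mul x (by simp) y hy
  · exact ⟨_, isCompact_Icc, fun f hf => hbd f hf (‖x‖ + 1) (by positivity) x (by linarith)⟩

end DiscountedHJ

theorem mainTheorem10 {N : ℕ}
    (H : DiscountedHJ.Space N → DiscountedHJ.Space N → ℝ)
    (hcont : DiscountedHJ.HamContinuous H)
    (hconv : DiscountedHJ.HamConvex H)
    (hcoer : DiscountedHJ.HamCoercive H)
    (hinf : DiscountedHJ.HamInfinity H) :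
    ∃ u : ℝ → C(DiscountedHJ.Space N, ℝ),
      (∀ lam : ℝ, 0 < lam →
        DiscountedHJ.IsMaximalSolution H lam (DiscountedHJ.criticalValue H) (u lam) ∧
          LocallyLipschitz (u lam)) ∧
      (∃ m : ℝ, ∀ lam : ℝ, 0 < lam → ∀ x, m ≤ u lam x) ∧
      IsCompact (closure (u '' Set.Ioi 0)) := by
  obtain ⟨m, L, B, hsol⟩ := DiscountedHJ.exists_maximalSolution hcont hconv hcoer hinf
  have hloc : ∀ u : DiscountedHJ.Space N → ℝ,
      (∀ R, 0 < R → LipschitzOnWith (Real.toNNReal (L R)) u (Metric.ball 0 R)) →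
      LocallyLipschitz u := fun u h x =>
    ⟨_, _, Metric.isOpen_ball.mem_nhds (by simp), h (‖x‖ + 1) (by positivity)⟩
  have hex : ∀ lam : ℝ, ∃ u : C(DiscountedHJ.Space N, ℝ), 0 < lam →
      DiscountedHJ.IsMaximalSolution H lam (DiscountedHJ.criticalValue H) u ∧ (∀ x, m ≤ u x) ∧
      (∀ R, 0 < R → LipschitzOnWith (Real.toNNReal (L R)) u (Metric.ball 0 R)) ∧
      ∀ R, 0 < R → ∀ x, ‖x‖ < R → u x ≤ B R := fun lam => by
    by_cases hlam : 0 < lam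
    · obtain ⟨u, h1, h2, h3⟩ := hsol lam hlam
      have h4 : ∀ R, 0 < R → LipschitzOnWith (Real.toNNReal (L R)) u (Metric.ball 0 R) :=
        fun R hR => DiscountedHJ.lipschitzOnWith_ball (h3 R hR).1
      exact ⟨⟨u, (hloc u h4).continuous⟩, fun _ => ⟨h1, h2, h4, fun R hR => (h3 R hR).2⟩⟩
    -- Nothing is required for nonpositive discount factors, so any value serves.
    · exact ⟨0, fun h => absurd h hlam⟩
  choose u hu using hex
  refine ⟨u, fun lam hlam => ⟨(hu lam hlam).1, hloc _ (hu lam hlam).2.2.1⟩,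
    ⟨m, fun lam hlam => (hu lam hlam).2.1⟩,
    DiscountedHJ.isCompact_closure_of_lipschitzOnWith (L := L) (B := B) (m := fun _ => m) ?_ ?_⟩
  · rintro _ ⟨lam, hlam, rfl⟩
    exact (hu lam hlam).2.2.1
  · rintro _ ⟨lam, hlam, rfl⟩ R hR x hx
    exact ⟨(hu lam hlam).2.1 x, (hu lam hlam).2.2.2 R hR x hx⟩
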